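/- A commutative square $n\circ g = m\circ f$ in a category, with $f\colon A\to B$, $g\colon A\to C$, $m\colon B\to D$, $n\colon C\to D$, is a weak pullback if for all $q\colon S\to B$ and $p\colon S\to C$ with $m\circ q=n\circ p$ there is a (not necessarily unique) $r\colon S\to A$ with $f\circ r=q$ and $g\circ r=p$. A monad $(T,\mu,\eta)$ on a category is Beck--Chevalley if $T$ maps weak pullback squares to weak pullback squares and $\mu$ is weakly cartesian, that is, for every morphism $f\colon X\to Y$ the naturality square $\mu_Y\circ TTf = Tf\circ\mu_X$ is a weak pullback. Let $\mathbf{StBorel}$ be the category of standard Borel spaces and measurable maps. The Giry monad $(P,\mu,\delta)$ on it sends $X$ to the space $PX$ of probability measures on $X$, with the $\sigma$-algebra generated by the evaluations $p\mapsto p(A)$ for $A\subseteq X$ measurable, and a measurable map to the pushforward of probability measures along it; its unit is $\delta_X(x)=\delta_x$ (the Dirac measure), and its multiplication is $\mu_X(\pi)(A)=\int_{PX}p(A)\,\pi(dp)$. Corollary. The Giry monad on standard Borel spaces is Beck--Chevalley. -/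

import Mathlib

open CategoryTheory CategoryTheory.Limits MeasureTheory

universe v u

/-! ### Weak pullbacks and Beck-Chevalley monads -/

namespace WeakCartesian

/-- The square `fst ≫ f = snd ≫ g` commutes and is a weak pullback: every commutative square on
`f` and `g` factors through it, not necessarily uniquely. -/
def IsWeakPullback {C : Type u} [Category.{v} C] {A X Y Z : C}
    (fst : A ⟶ X) (snd : A ⟶ Y) (f : X ⟶ Z) (g : Y ⟶ Z) : Prop :=
  ∃ w : fst ≫ f = snd ≫ g, Nonempty (IsWeakLimit (PullbackCone.mk fst snd w))

/-- The defining property of a weak pullback, spelled out. -/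
theorem isWeakPullback_iff {C : Type u} [Category.{v} C] {A X Y Z : C}
    (fst : A ⟶ X) (snd : A ⟶ Y) (f : X ⟶ Z) (g : Y ⟶ Z) :
    IsWeakPullback fst snd f g ↔ fst ≫ f = snd ≫ g ∧
      ∀ (S : C) (p : S ⟶ X) (q : S ⟶ Y), p ≫ f = q ≫ g →
        ∃ r : S ⟶ A, r ≫ fst = p ∧ r ≫ snd = q := by
  constructor
  · rintro ⟨w, ⟨h⟩⟩
    exact ⟨w, fun S p q e => ⟨PullbackCone.IsWeakLimit.lift h p q e,
      PullbackCone.IsWeakLimit.lift_fst h p q e, PullbackCone.IsWeakLimit.lift_snd h p q e⟩⟩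
  · rintro ⟨w, h⟩
    choose l hl using fun s : PullbackCone f g => h s.pt s.fst s.snd s.condition
    exact ⟨w, ⟨PullbackCone.IsWeakLimit.mk w l (fun s => (hl s).1) (fun s => (hl s).2)⟩⟩

/-- A functor is weakly cartesian if it sends weak pullback squares to weak pullback squares. -/
def PreservesWeakPullbacks {C : Type u} [Category.{v} C] (F : C ⥤ C) : Prop :=
  ∀ ⦃A X Y Z : C⦄ (fst : A ⟶ X) (snd : A ⟶ Y) (f : X ⟶ Z) (g : Y ⟶ Z),
    IsWeakPullback fst snd f g →
      IsWeakPullback (F.map fst) (F.map snd) (F.map f) (F.map g)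

/-- A natural transformation is weakly cartesian if its naturality squares are weak pullbacks. -/
def IsWeaklyCartesian {C : Type u} [Category.{v} C] {F G : C ⥤ C} (α : F ⟶ G) : Prop :=
  ∀ ⦃X Y : C⦄ (f : X ⟶ Y), IsWeakPullback (F.map f) (α.app X) (α.app Y) (G.map f)

/-- A monad is Beck-Chevalley if its functor preserves weak pullbacks and its multiplication is
weakly cartesian. -/
structure IsBeckChevalley {C : Type u} [Category.{v} C] (T : CategoryTheory.Monad C) : Prop where
  preservesWeakPullbacks : PreservesWeakPullbacks T.toFunctor
  mul_isWeaklyCartesian : IsWeaklyCartesian T.μ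

end WeakCartesian

/-! ### The space of probability measures on a standard Borel space -/

namespace GirySB

/-- The Giry sigma-algebra on probability measures is the one generated by the evaluations. -/
theorem measurable_of_eval {α β : Type*} [MeasurableSpace α] [MeasurableSpace β]
    {f : α → ProbabilityMeasure β}
    (h : ∀ s, MeasurableSet s → Measurable fun a => (f a : Measure β) s) : Measurable f :=
  Measurable.subtype_mk (Measure.measurable_of_measurable_coe _ h)

theorem measurable_toMeasure {β : Type*} [MeasurableSpace β] :
    Measurable (ProbabilityMeasure.toMeasure : ProbabilityMeasure β → Measure β) :=
  measurable_subtype_coe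

theorem measurable_eval {β : Type*} [MeasurableSpace β] {s : Set β} (hs : MeasurableSet s) :
    Measurable fun μ : ProbabilityMeasure β => (μ : Measure β) s :=
  (Measure.measurable_coe hs).comp measurable_toMeasure

/-- Pushforward of probability measures along a measurable map. -/
noncomputable def push {α β : Type*} [MeasurableSpace α] [MeasurableSpace β] (f : α → β)
    (hf : Measurable f) (μ : ProbabilityMeasure α) : ProbabilityMeasure β :=
  μ.map hf.aemeasurable

theorem measurable_push {α β : Type*} [MeasurableSpace α] [MeasurableSpace β] (f : α → β)
    (hf : Measurable f) : Measurable (push f hf) :=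
  ((Measure.measurable_map f hf).comp measurable_toMeasure).subtype_mk

/-- The Dirac measure at a point. -/
noncomputable def dirac {α : Type*} [MeasurableSpace α] (a : α) : ProbabilityMeasure α :=
  ⟨Measure.dirac a, inferInstance⟩

theorem measurable_dirac {α : Type*} [MeasurableSpace α] :
    Measurable (dirac : α → ProbabilityMeasure α) :=
  Measure.measurable_dirac.subtype_mk

/-- The expected measure `s ↦ ∫ μ s dπ(μ)` of a probability measure `π` on probability
measures. -/
noncomputable def join {α : Type*} [MeasurableSpace α]
    (π : ProbabilityMeasure (ProbabilityMeasure α)) : ProbabilityMeasure α :=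
  ⟨(π : Measure (ProbabilityMeasure α)).bind ProbabilityMeasure.toMeasure,
    isProbabilityMeasure_bind measurable_toMeasure.aemeasurable
      (Filter.Eventually.of_forall fun _ => inferInstance)⟩

theorem join_apply {α : Type*} [MeasurableSpace α]
    (π : ProbabilityMeasure (ProbabilityMeasure α)) {s : Set α} (hs : MeasurableSet s) :
    (join π : Measure α) s
      = ∫⁻ μ, (μ : Measure α) s ∂(π : Measure (ProbabilityMeasure α)) :=
  Measure.bind_apply hs measurable_toMeasure.aemeasurable

theorem measurable_join {α : Type*} [MeasurableSpace α] :
    Measurable (join : ProbabilityMeasure (ProbabilityMeasure α) → ProbabilityMeasure α) := by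
  refine measurable_of_eval fun s hs => ?_
  simp only [join_apply _ hs]
  exact (Measure.measurable_lintegral (measurable_eval hs)).comp measurable_toMeasure

theorem ext_apply {α : Type*} [MeasurableSpace α] {μ ν : ProbabilityMeasure α}
    (h : ∀ s, MeasurableSet s → (μ : Measure α) s = (ν : Measure α) s) : μ = ν :=
  Subtype.ext (Measure.ext h)

theorem push_apply {α β : Type*} [MeasurableSpace α] [MeasurableSpace β] (f : α → β)
    (hf : Measurable f) (μ : ProbabilityMeasure α) {s : Set β} (hs : MeasurableSet s) :
    (push f hf μ : Measure β) s = (μ : Measure α) (f ⁻¹' s) :=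
  Measure.map_apply hf hs

theorem dirac_apply {α : Type*} [MeasurableSpace α] (a : α) {s : Set α} (hs : MeasurableSet s) :
    (dirac a : Measure α) s = s.indicator 1 a :=
  Measure.dirac_apply' a hs

theorem lintegral_push {α β : Type*} [MeasurableSpace α] [MeasurableSpace β] (f : α → β)
    (hf : Measurable f) (μ : ProbabilityMeasure α) {g : β → ENNReal} (hg : Measurable g) :
    ∫⁻ b, g b ∂(push f hf μ : Measure β) = ∫⁻ a, g (f a) ∂(μ : Measure α) :=
  lintegral_map hg hf

theorem lintegral_join {α : Type*} [MeasurableSpace α]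
    (π : ProbabilityMeasure (ProbabilityMeasure α)) {g : α → ENNReal} (hg : Measurable g) :
    ∫⁻ a, g a ∂(join π : Measure α)
      = ∫⁻ μ, ∫⁻ a, g a ∂(μ : Measure α) ∂(π : Measure (ProbabilityMeasure α)) :=
  Measure.lintegral_bind measurable_toMeasure.aemeasurable hg.aemeasurable

/-- Weak convergence makes the evaluations at measurable sets Borel measurable. -/
theorem giry_le_borel (K : Type*) [TopologicalSpace K]
    [TopologicalSpace.MetrizableSpace K] [MeasurableSpace K] [BorelSpace K] :
    (inferInstance : MeasurableSpace (ProbabilityMeasure K)) ≤ borel (ProbabilityMeasure K) := by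
  have h : @Measurable _ _ (borel (ProbabilityMeasure K)) _
      (ProbabilityMeasure.toMeasure : ProbabilityMeasure K → Measure K) := by
    let := borel (ProbabilityMeasure K)
    have : BorelSpace (ProbabilityMeasure K) := ⟨rfl⟩
    have hp : ∀ μ : ProbabilityMeasure K, IsProbabilityMeasure (μ : Measure K) :=
      fun μ => inferInstance
    refine Measurable.measure_of_isPiSystem_of_isProbabilityMeasure
      (BorelSpace.measurable_eq (α := K)) isPiSystem_isOpen fun G hG => ?_
    refine LowerSemicontinuous.measurable (lowerSemicontinuous_iff_le_liminf.2 fun μ => ?_)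
    exact ProbabilityMeasure.le_liminf_measure_open_of_tendsto Filter.tendsto_id hG
  exact h.comap_le

/-- On a compact metrizable space the Giry sigma-algebra is the Borel sigma-algebra of the
topology of weak convergence. -/
theorem borelSpace_of_compact (K : Type*) [TopologicalSpace K] [CompactSpace K]
    [TopologicalSpace.MetrizableSpace K] [MeasurableSpace K] [BorelSpace K] :
    BorelSpace (ProbabilityMeasure K) := by
  have hle := giry_le_borel K
  refine ⟨le_antisymm hle ?_⟩
  have : SecondCountableTopology K := inferInstance
  let 𝒜 : Set (Set K) := generateSetAlgebra (TopologicalSpace.countableBasis K)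
  have hc : 𝒜.Countable :=
    countable_generateSetAlgebra (TopologicalSpace.countable_countableBasis K)
  have hgen : (inferInstance : MeasurableSpace K) = MeasurableSpace.generateFrom 𝒜 := by
    rw [generateFrom_generateSetAlgebra_eq]
    exact (TopologicalSpace.isBasis_countableBasis K).borel_eq_generateFrom ▸
      BorelSpace.measurable_eq (α := K)
  have hms : ∀ s : 𝒜, MeasurableSet (s : Set K) := fun s => by
    have h := MeasurableSpace.measurableSet_generateFrom s.2
    rwa [← hgen] at h
  have : Countable 𝒜 := hc.to_subtype
  let e : ProbabilityMeasure K → (𝒜 → ENNReal) := fun μ s => (μ : Measure K) s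
  have he : Measurable e := measurable_pi_lambda _ fun s => measurable_eval (hms s)
  have hinj : Function.Injective e := fun μ ν h => by
    have h' : (μ : Measure K) = (ν : Measure K) :=
      ext_of_generate_finite 𝒜 hgen
        isSetAlgebra_generateSetAlgebra.isSetRing.isSetSemiring.isPiSystem
        (fun s hs => congrFun h ⟨s, hs⟩) (by simp only [measure_univ])
    exact Subtype.ext h'
  have hstd : @StandardBorelSpace _ (borel (ProbabilityMeasure K)) := by
    let := borel (ProbabilityMeasure K)
    have : BorelSpace (ProbabilityMeasure K) := ⟨rfl⟩
    let := TopologicalSpace.metrizableSpaceMetric (ProbabilityMeasure K)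
    infer_instance
  have hemb : @MeasurableEmbedding _ _ (borel (ProbabilityMeasure K)) _ e :=
    @Measurable.measurableEmbedding _ _ _ e _ (borel (ProbabilityMeasure K)) hstd
      (he.mono hle le_rfl) hinj
  rw [← @MeasurableEmbedding.comap_eq _ _ (borel (ProbabilityMeasure K)) _ e hemb]
  exact he.comap_le

theorem standardBorel_of_compact (K : Type*) [TopologicalSpace K] [CompactSpace K]
    [TopologicalSpace.MetrizableSpace K] [MeasurableSpace K] [BorelSpace K] :
    StandardBorelSpace (ProbabilityMeasure K) := by
  have := borelSpace_of_compact K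
  let := TopologicalSpace.metrizableSpaceMetric (ProbabilityMeasure K)
  infer_instance

theorem standardBorel_of_equiv {α β : Type*} [MeasurableSpace α] [MeasurableSpace β]
    [StandardBorelSpace α] (E : α ≃ᵐ β) : StandardBorelSpace β := by
  let := upgradeStandardBorel α
  let τ : TopologicalSpace β := TopologicalSpace.induced E.symm inferInstance
  have hind : Topology.IsInducing E.symm := ⟨rfl⟩
  have hpol : PolishSpace β :=
    (E.symm.toEquiv.toHomeomorphOfIsInducing hind).isClosedEmbedding.polishSpace
  have hbor : BorelSpace β := by
    have h := congrArg (MeasurableSpace.comap (E.symm : β → α)) (eq_borel_upgradeStandardBorel α)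
    exact ⟨E.symm.measurableEmbedding.comap_eq.symm.trans (h.trans borel_comap.symm)⟩
  infer_instance

/-- The probability measures on a standard Borel space form a standard Borel space. -/
theorem standardBorel_probabilityMeasure (X : Type*) [MeasurableSpace X] [StandardBorelSpace X] :
    StandardBorelSpace (ProbabilityMeasure X) := by
  obtain ⟨f, hf, hinj⟩ := MeasurableSpace.measurable_injection_nat_bool_of_countablySeparated X
  have hemb : MeasurableEmbedding f := hf.measurableEmbedding hinj
  have hK : StandardBorelSpace (ProbabilityMeasure (ℕ → Bool)) :=
    standardBorel_of_compact (ℕ → Bool)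
  let R : Set (ProbabilityMeasure (ℕ → Bool)) :=
    {μ | (μ : Measure (ℕ → Bool)) (Set.range f) = 1}
  have hR : MeasurableSet R :=
    measurable_eval hemb.measurableSet_range (measurableSet_singleton 1)
  have hRstd : StandardBorelSpace R := hR.standardBorel
  have hcomap : ∀ μ : R, (Measure.map f (Measure.comap f (μ.1 : Measure (ℕ → Bool)))) = μ.1 := by
    intro μ
    rw [hemb.map_comap]
    refine Measure.restrict_eq_self_of_ae_mem ?_
    exact (prob_compl_eq_zero_iff hemb.measurableSet_range).2 μ.2
  have hprob : ∀ μ : R, IsProbabilityMeasure (Measure.comap f (μ.1 : Measure (ℕ → Bool))) := by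
    intro μ
    refine ⟨?_⟩
    rw [hemb.comap_apply, Set.image_univ]
    exact μ.2
  have hpush : ∀ ν : ProbabilityMeasure X, push f hf ν ∈ R := by
    intro ν
    change (push f hf ν : Measure (ℕ → Bool)) (Set.range f) = 1
    rw [push_apply f hf ν hemb.measurableSet_range, Set.preimage_range, measure_univ]
  let E : R ≃ᵐ ProbabilityMeasure X :=
    { toFun := fun μ => ⟨Measure.comap f (μ.1 : Measure (ℕ → Bool)), hprob μ⟩
      invFun := fun ν => ⟨push f hf ν, hpush ν⟩
      left_inv := fun μ => Subtype.ext (Subtype.ext (hcomap μ))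
      right_inv := fun ν => Subtype.ext (hemb.comap_map _)
      measurable_toFun := measurable_of_eval fun s hs => by
        change Measurable fun μ : R => Measure.comap f (μ.1 : Measure (ℕ → Bool)) s
        simp only [hemb.comap_apply]
        exact (measurable_eval (hemb.measurableSet_image.2 hs)).comp measurable_subtype_coe
      measurable_invFun := (measurable_push f hf).subtype_mk (h := hpush) }
  exact standardBorel_of_equiv E

theorem join_push_push {α β : Type*} [MeasurableSpace α] [MeasurableSpace β] (f : α → β)
    (hf : Measurable f) (π : ProbabilityMeasure (ProbabilityMeasure α)) :
    join (push (push f hf) (measurable_push f hf) π) = push f hf (join π) :=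
  ext_apply fun s hs => by
    rw [join_apply _ hs, push_apply _ _ _ hs, join_apply _ (hf hs),
      lintegral_push _ _ _ (measurable_eval hs)]
    simp only [push_apply _ _ _ hs]

theorem join_push_join {α : Type*} [MeasurableSpace α]
    (π : ProbabilityMeasure (ProbabilityMeasure (ProbabilityMeasure α))) :
    join (push join measurable_join π) = join (join π) :=
  ext_apply fun s hs => by
    rw [join_apply _ hs, join_apply _ hs, lintegral_push _ _ _ (measurable_eval hs),
      lintegral_join _ (measurable_eval hs)]
    simp only [join_apply _ hs]

theorem join_dirac {α : Type*} [MeasurableSpace α] (μ : ProbabilityMeasure α) :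
    join (dirac μ) = μ :=
  ext_apply fun s hs => by
    rw [join_apply _ hs]
    exact lintegral_dirac' _ (measurable_eval hs)

theorem join_push_dirac {α : Type*} [MeasurableSpace α] (μ : ProbabilityMeasure α) :
    join (push dirac measurable_dirac μ) = μ :=
  ext_apply fun s hs => by
    rw [join_apply _ hs, lintegral_push _ _ _ (measurable_eval hs)]
    simp only [dirac_apply _ hs]
    exact lintegral_indicator_one hs

/-! ### The Giry monad on standard Borel spaces -/

/-- The category of standard Borel spaces and measurable maps. -/
abbrev StdBorel : Type (u + 1) :=
  ObjectProperty.FullSubcategory fun X : MeasCat.{u} => StandardBorelSpace X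

instance (X : StdBorel.{u}) : StandardBorelSpace X.obj := X.property

/-- The space of probability measures, with the sigma-algebra generated by the evaluations. -/
noncomputable def prob (X : StdBorel.{u}) : StdBorel.{u} :=
  ⟨MeasCat.of (ProbabilityMeasure X.obj), standardBorel_probabilityMeasure X.obj⟩

/-- The endofunctor sending a standard Borel space to its space of probability measures, and a
measurable map to the pushforward of probability measures along it. -/
noncomputable def probFunctor : StdBorel.{u} ⥤ StdBorel.{u} where
  obj X := prob X
  map f := ObjectProperty.homMk ⟨push f.hom.1 f.hom.2, measurable_push _ f.hom.2⟩
  map_id _ := ObjectProperty.hom_ext _ <| Subtype.ext <| funext fun _ =>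
    Subtype.ext Measure.map_id
  map_comp f g := ObjectProperty.hom_ext _ <| Subtype.ext <| funext fun _ =>
    Subtype.ext (Measure.map_map g.hom.2 f.hom.2).symm

/-- The Giry monad on standard Borel spaces: the unit is given by Dirac measures, the
multiplication by expected measures. -/
noncomputable def giry : CategoryTheory.Monad StdBorel.{u} where
  toFunctor := probFunctor
  η :=
    { app := fun _ => ObjectProperty.homMk ⟨dirac, measurable_dirac⟩
      naturality := fun _ _ f => ObjectProperty.hom_ext _ <| Subtype.ext <| funext fun a =>
        Subtype.ext (Measure.map_dirac' f.hom.2 a).symm }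
  μ :=
    { app := fun _ => ObjectProperty.homMk ⟨join, measurable_join⟩
      naturality := fun _ _ f => ObjectProperty.hom_ext _ <| Subtype.ext <| funext fun π =>
        join_push_push f.hom.1 f.hom.2 π }
  assoc _ := ObjectProperty.hom_ext _ <| Subtype.ext <| funext fun π => join_push_join π
  left_unit _ := ObjectProperty.hom_ext _ <| Subtype.ext <| funext fun μ => join_dirac μ
  right_unit _ := ObjectProperty.hom_ext _ <| Subtype.ext <| funext fun μ => join_push_dirac μ

end GirySB

open ProbabilityTheory

namespace GirySB

/-! Both conditions say that certain families of measures can be lifted, measurably in a parameter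
`s`. The tool is disintegration along `f` (`exists_disintegration`): `p s` is the mixture of fibre
measures `K (s, y)` over its image under `f`, with `K` jointly measurable in `s` and `y`.

For preservation of weak pullbacks, families with the same image in `Z` are coupled by making the
two coordinates conditionally independent over `Z` (`exists_family_fiberProduct`).

For the multiplication, a measure `θ` on `Y` lifts to `∫ K (s, y) dθ(y)` on `X`, and `π s` is pushed
forward along this lift (`exists_family_lift_join`). The lift is right only off a null set of the
expected measure of `π s`, which suffices. -/

/-- A measurable family of probability measures, as a kernel. -/
noncomputable def familyKernel {S X : Type*} [MeasurableSpace S] [MeasurableSpace X]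
    (p : S → ProbabilityMeasure X) (hp : Measurable p) : Kernel S X :=
  ⟨fun s => (p s : Measure X), measurable_toMeasure.comp hp⟩

instance {S X : Type*} [MeasurableSpace S] [MeasurableSpace X]
    (p : S → ProbabilityMeasure X) (hp : Measurable p) : IsMarkovKernel (familyKernel p hp) :=
  ⟨fun s => inferInstanceAs (IsProbabilityMeasure (p s : Measure X))⟩

/-- A Markov kernel, as a measurable family of probability measures. -/
noncomputable def kernelFamily {S X : Type*} [MeasurableSpace S] [MeasurableSpace X]
    (κ : Kernel S X) [IsMarkovKernel κ] (s : S) : ProbabilityMeasure X :=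
  ⟨κ s, inferInstance⟩

theorem measurable_kernelFamily {S X : Type*} [MeasurableSpace S] [MeasurableSpace X]
    (κ : Kernel S X) [IsMarkovKernel κ] : Measurable (kernelFamily κ) :=
  κ.measurable.subtype_mk

/-! ### Disintegration and lifting of measurable families -/

/-- A measurable family of probability measures can be disintegrated along a measurable map, with
fibre measures that depend measurably on the parameter as well. -/
theorem exists_disintegration {S X Y : Type*} [MeasurableSpace S] [StandardBorelSpace S]
    [MeasurableSpace X] [StandardBorelSpace X] [Nonempty X]
    [MeasurableSpace Y] [StandardBorelSpace Y]
    (f : X → Y) (hf : Measurable f) (p : S → ProbabilityMeasure X) (hp : Measurable p) :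
    ∃ K : Kernel (S × Y) X, IsMarkovKernel K ∧ ∀ s,
      (∀ A, MeasurableSet A →
        (p s : Measure X) A = ∫⁻ y, K (s, y) A ∂(push f hf (p s) : Measure Y)) ∧
      ∀ᵐ y ∂(push f hf (p s) : Measure Y), ∀ᵐ x ∂K (s, y), f x = y := by
  have hg : Measurable fun x => (f x, x) := hf.prodMk measurable_id
  -- On the graph of `f`, conditioning on the first coordinate amounts to disintegrating along `f`.
  let κ : Kernel S (Y × X) := (familyKernel p hp).map fun x => (f x, x)
  have : IsMarkovKernel κ := Kernel.IsMarkovKernel.map _ hg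
  have hκ : ∀ s, κ s = (p s : Measure X).map fun x => (f x, x) := fun s =>
    Kernel.map_apply _ hg s
  have hfst : ∀ s, κ.fst s = (push f hf (p s) : Measure Y) := fun s => by
    rw [Kernel.fst_apply, hκ, Measure.map_map measurable_fst hg]
    rfl
  refine ⟨κ.condKernel, inferInstance, fun s => ⟨fun A hA => ?_, ?_⟩⟩
  · have h := Kernel.compProd_apply (s := Prod.snd ⁻¹' A) (measurable_snd hA) κ.fst κ.condKernel s
    rw [κ.disintegrate κ.condKernel, hκ, Measure.map_apply hg (measurable_snd hA), hfst] at h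
    exact h
  · rw [← hfst]
    refine Kernel.ae_ae_of_ae_compProd (p := fun z : Y × X => f z.2 = z.1) ?_
    rw [κ.disintegrate κ.condKernel, hκ]
    exact (ae_map_iff hg.aemeasurable
      (measurableSet_eq_fun (hf.comp measurable_snd) measurable_fst)).2 (ae_of_all _ fun _ => rfl)

/-- Two measurable families of probability measures with the same image in `Z` are the marginals
of a measurable family of probability measures on the fibre product over `Z`. -/
theorem exists_family_fiberProduct {S X Y Z : Type*} [MeasurableSpace S] [StandardBorelSpace S]
    [MeasurableSpace X] [StandardBorelSpace X] [Nonempty X]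
    [MeasurableSpace Y] [StandardBorelSpace Y] [Nonempty Y]
    [MeasurableSpace Z] [StandardBorelSpace Z]
    (f : X → Z) (hf : Measurable f) (g : Y → Z) (hg : Measurable g)
    (p : S → ProbabilityMeasure X) (hp : Measurable p)
    (q : S → ProbabilityMeasure Y) (hq : Measurable q)
    (h : ∀ s, push f hf (p s) = push g hg (q s)) :
    ∃ r : S → ProbabilityMeasure {z : X × Y // f z.1 = g z.2}, Measurable r ∧
      (∀ s, push (fun z => z.1.1) (measurable_fst.comp measurable_subtype_coe) (r s) = p s) ∧
      ∀ s, push (fun z => z.1.2) (measurable_snd.comp measurable_subtype_coe) (r s) = q s := by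
  obtain ⟨K, hK, hKp⟩ := exists_disintegration f hf p hp
  obtain ⟨L, hL, hLq⟩ := exists_disintegration g hg q hq
  -- Both disintegrations now have the same base measure on `Z`.
  simp only [← h] at hLq
  let ν : Kernel S Z := familyKernel (fun s => push f hf (p s)) ((measurable_push f hf).comp hp)
  -- Draw `z` from the common image, then `x` and `y` independently from the fibres over `z`.
  let ρ : Kernel S (X × Y) := (ν ⊗ₖ (K ×ₖ L)).snd
  have hρ : ∀ s T, MeasurableSet T → ρ s T =
      ∫⁻ z, ((K (s, z)).prod (L (s, z))) T ∂(push f hf (p s) : Measure Z) := fun s T hT => by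
    rw [Kernel.snd_apply' _ _ hT, Kernel.compProd_apply (measurable_snd hT)]
    simp only [Kernel.prod_apply]
    rfl
  have hE : MeasurableSet {z : X × Y | f z.1 = g z.2} :=
    measurableSet_eq_fun (hf.comp measurable_fst) (hg.comp measurable_snd)
  have hemb : MeasurableEmbedding (Subtype.val : {z : X × Y // f z.1 = g z.2} → X × Y) :=
    MeasurableEmbedding.subtype_coe hE
  have hρE : ∀ s, ∀ᵐ z ∂ρ s, f z.1 = g z.2 := fun s => by
    change ρ s {z : X × Y | f z.1 = g z.2}ᶜ = 0
    rw [hρ s _ hE.compl]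
    refine (lintegral_congr_ae ?_).trans lintegral_zero
    filter_upwards [(hKp s).2, (hLq s).2] with z hx hy
    change ∀ᵐ w ∂(K (s, z)).prod (L (s, z)), f w.1 = g w.2
    filter_upwards [Measure.quasiMeasurePreserving_fst.ae hx,
      Measure.quasiMeasurePreserving_snd.ae hy] with w h₁ h₂
    exact h₁.trans h₂.symm
  -- As `ρ s` is concentrated on the fibre product, restricting it there loses no mass.
  have hmap : ∀ s, ((ρ s).comap Subtype.val).map
      (Subtype.val : {z : X × Y // f z.1 = g z.2} → X × Y) = ρ s := fun s => by
    rw [hemb.map_comap]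
    exact Measure.restrict_eq_self_of_ae_mem ((hρE s).mono fun z hz => ⟨⟨z, hz⟩, rfl⟩)
  have hprob : ∀ s, IsProbabilityMeasure
      ((ρ s).comap (Subtype.val : {z : X × Y // f z.1 = g z.2} → X × Y)) := fun s => by
    refine ⟨?_⟩
    have h1 := congrArg (fun m => m Set.univ) (hmap s)
    simpa [Measure.map_apply measurable_subtype_coe MeasurableSet.univ] using h1
  let r : S → ProbabilityMeasure {z : X × Y // f z.1 = g z.2} := fun s => ⟨_, hprob s⟩
  refine ⟨r, measurable_of_eval fun T hT => ?_, fun s => ?_, fun s => ?_⟩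
  · change Measurable fun s => (ρ s).comap Subtype.val T
    simp only [hemb.comap_apply]
    exact ρ.measurable_coe (hemb.measurableSet_image.2 hT)
  · refine ext_apply fun A hA => ?_
    have h1 := congrArg (fun m => m (Prod.fst ⁻¹' A)) (hmap s)
    simp only [Measure.map_apply measurable_subtype_coe (measurable_fst hA)] at h1
    rw [push_apply _ _ _ hA, (hKp s).1 A hA]
    refine h1.trans ((hρ s _ (measurable_fst hA)).trans (lintegral_congr fun z => ?_))
    rw [← Measure.map_apply measurable_fst hA, Measure.map_fst_prod, measure_univ, one_smul]
  · refine ext_apply fun A hA => ?_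
    have h1 := congrArg (fun m => m (Prod.snd ⁻¹' A)) (hmap s)
    simp only [Measure.map_apply measurable_subtype_coe (measurable_snd hA)] at h1
    rw [push_apply _ _ _ hA, (hLq s).1 A hA]
    refine h1.trans ((hρ s _ (measurable_snd hA)).trans (lintegral_congr fun z => ?_))
    rw [← Measure.map_apply measurable_snd hA, Measure.map_snd_prod, measure_univ, one_smul]

/-- A measurable family of measures on probability measures on `Y`, whose expected measures are
the images of a measurable family of probability measures on `X`, lifts to `X`. -/
theorem exists_family_lift_join {S X Y : Type*} [MeasurableSpace S] [StandardBorelSpace S]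
    [MeasurableSpace X] [StandardBorelSpace X] [Nonempty X]
    [MeasurableSpace Y] [StandardBorelSpace Y]
    (f : X → Y) (hf : Measurable f)
    (π : S → ProbabilityMeasure (ProbabilityMeasure Y)) (hπ : Measurable π)
    (p : S → ProbabilityMeasure X) (hp : Measurable p)
    (h : ∀ s, join (π s) = push f hf (p s)) :
    ∃ r : S → ProbabilityMeasure (ProbabilityMeasure X), Measurable r ∧
      (∀ s, push (push f hf) (measurable_push f hf) (r s) = π s) ∧ ∀ s, join (r s) = p s := by
  obtain ⟨K, hK, hKp⟩ := exists_disintegration f hf p hp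
  let ε : Kernel (S × ProbabilityMeasure Y) Y := familyKernel Prod.snd measurable_snd
  -- `K'` ignores `θ`, so `σ (s, θ)` is the mixture of the fibre measures `K (s, y)` with `y` drawn
  -- from `θ`.
  let K' : Kernel ((S × ProbabilityMeasure Y) × Y) X :=
    K.comap (fun z => (z.1.1, z.2)) (by fun_prop)
  let σ : Kernel (S × ProbabilityMeasure Y) X := (ε ⊗ₖ K').snd
  have hσ : ∀ s θ A, MeasurableSet A →
      σ (s, θ) A = ∫⁻ y, K (s, y) A ∂(θ : Measure Y) := fun s θ A hA => by
    rw [Kernel.snd_apply' _ _ hA, Kernel.compProd_apply (measurable_snd hA)]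
    rfl
  have hσm : ∀ s, Measurable fun θ => kernelFamily σ (s, θ) := fun s =>
    (measurable_kernelFamily σ).comp measurable_prodMk_left
  refine ⟨fun s => push (fun θ => kernelFamily σ (s, θ)) (hσm s) (π s),
    measurable_of_eval fun T hT => ?_, fun s => ext_apply fun T hT => ?_,
    fun s => ext_apply fun A hA => ?_⟩
  · simp only [push_apply _ _ _ hT]
    exact Kernel.measurable_kernel_prodMk_left (κ := familyKernel π hπ)
      ((measurable_kernelFamily σ) hT)
  · rw [push_apply _ _ _ hT, push_apply _ _ _ (measurable_push f hf hT)]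
    -- A null set of the expected measure is `θ`-null for `π s`-almost every `θ`; for those `θ`, `σ
    -- (s, θ)` has image `θ`.
    have hae : ∀ᵐ y ∂(join (π s) : Measure Y), ∀ᵐ x ∂K (s, y), f x = y := by
      rw [h]
      exact (hKp s).2
    refine measure_congr ?_
    filter_upwards [Measure.ae_ae_of_ae_bind measurable_toMeasure.aemeasurable hae] with θ hθ
    have hfix : push f hf (kernelFamily σ (s, θ)) = θ := ext_apply fun B hB => by
      rw [push_apply _ _ _ hB]
      refine (hσ s θ _ (hf hB)).trans ?_
      rw [← lintegral_indicator_one hB]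
      refine lintegral_congr_ae ?_
      filter_upwards [hθ] with y hy
      by_cases hyB : y ∈ B
      · rw [Set.indicator_of_mem hyB, Pi.one_apply]
        exact (mem_ae_iff_prob_eq_one (hf hB)).1 (hy.mono fun x hx => hx.symm ▸ hyB)
      · rw [Set.indicator_of_notMem hyB]
        exact measure_eq_zero_iff_ae_notMem.2 (hy.mono fun x hx hxB => hyB (hx ▸ hxB))
    exact congrArg T hfix
  -- Integrating `K (s, y) A` over `θ` and then over `π s` is integrating it over the image of `p
  -- s`, which gives back `p s A`.
  · rw [join_apply _ hA, lintegral_push _ _ _ (measurable_eval hA), (hKp s).1 A hA, ← h,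
      lintegral_join (g := fun y => K (s, y) A) _ ((K.measurable_coe hA).comp measurable_prodMk_left)]
    exact lintegral_congr fun θ => hσ s θ A hA

/-! ### The two Beck-Chevalley conditions -/

theorem preservesWeakPullbacks_probFunctor :
    WeakCartesian.PreservesWeakPullbacks probFunctor.{u} := by
  intro A X Y Z a b f g hw
  rw [WeakCartesian.isWeakPullback_iff] at hw ⊢
  obtain ⟨w, hlift⟩ := hw
  refine ⟨by rw [← Functor.map_comp, w, Functor.map_comp], fun S p q hpq => ?_⟩
  have happ : ∀ s, push f.hom.1 f.hom.2 (p.hom.1 s) = push g.hom.1 g.hom.2 (q.hom.1 s) :=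
    fun s => congrFun (congrArg (fun k => k.hom.1) hpq) s
  -- Disintegration needs nonempty spaces. A point of `S` provides probability measures on `X` and
  -- `Y`, hence points; for empty `S` there is nothing to lift.
  rcases isEmpty_or_nonempty S.obj with hS | ⟨⟨s₀⟩⟩
  · exact ⟨ObjectProperty.homMk ⟨fun s => isEmptyElim s, measurable_of_empty _⟩,
      ObjectProperty.hom_ext _ <| Subtype.ext <| funext fun s => isEmptyElim s,
      ObjectProperty.hom_ext _ <| Subtype.ext <| funext fun s => isEmptyElim s⟩
  have : Nonempty X.obj := (p.hom.1 s₀).nonempty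
  have : Nonempty Y.obj := (q.hom.1 s₀).nonempty
  obtain ⟨r, hr, hrp, hrq⟩ := exists_family_fiberProduct f.hom.1 f.hom.2 g.hom.1 g.hom.2
    p.hom.1 p.hom.2 q.hom.1 q.hom.2 happ
  have hE : MeasurableSet {z : X.obj × Y.obj | f.hom.1 z.1 = g.hom.1 z.2} :=
    measurableSet_eq_fun (f.hom.2.comp measurable_fst) (g.hom.2.comp measurable_snd)
  -- The set-theoretic fibre product is standard Borel, and the weak pullback property gives `l`
  -- from it to `A` over both projections. So lifting to measures on `F` is enough.
  let F : StdBorel.{u} :=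
    ⟨MeasCat.of {z : X.obj × Y.obj // f.hom.1 z.1 = g.hom.1 z.2}, hE.standardBorel⟩
  let π₁ : F ⟶ X :=
    ObjectProperty.homMk ⟨fun z => z.1.1, measurable_fst.comp measurable_subtype_coe⟩
  let π₂ : F ⟶ Y :=
    ObjectProperty.homMk ⟨fun z => z.1.2, measurable_snd.comp measurable_subtype_coe⟩
  obtain ⟨l, hl₁, hl₂⟩ := hlift F π₁ π₂
    (ObjectProperty.hom_ext _ <| Subtype.ext <| funext fun z => z.2)
  let r' : S ⟶ probFunctor.obj F := ObjectProperty.homMk ⟨r, hr⟩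
  refine ⟨r' ≫ probFunctor.map l, ?_, ?_⟩
  · rw [Category.assoc, ← Functor.map_comp, hl₁]
    exact ObjectProperty.hom_ext _ <| Subtype.ext <| funext hrp
  · rw [Category.assoc, ← Functor.map_comp, hl₂]
    exact ObjectProperty.hom_ext _ <| Subtype.ext <| funext hrq

theorem isWeaklyCartesian_giry_mul : WeakCartesian.IsWeaklyCartesian giry.{u}.μ := by
  intro X Y f
  rw [WeakCartesian.isWeakPullback_iff]
  refine ⟨giry.μ.naturality f, fun S π p hπp => ?_⟩
  have happ : ∀ s, join (π.hom.1 s) = push f.hom.1 f.hom.2 (p.hom.1 s) :=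
    fun s => congrFun (congrArg (fun k => k.hom.1) hπp) s
  rcases isEmpty_or_nonempty S.obj with hS | ⟨⟨s₀⟩⟩
  · exact ⟨ObjectProperty.homMk ⟨fun s => isEmptyElim s, measurable_of_empty _⟩,
      ObjectProperty.hom_ext _ <| Subtype.ext <| funext fun s => isEmptyElim s,
      ObjectProperty.hom_ext _ <| Subtype.ext <| funext fun s => isEmptyElim s⟩
  have : Nonempty X.obj := (p.hom.1 s₀).nonempty
  obtain ⟨r, hr, hrπ, hrp⟩ := exists_family_lift_join f.hom.1 f.hom.2
    π.hom.1 π.hom.2 p.hom.1 p.hom.2 happ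
  exact ⟨ObjectProperty.homMk ⟨r, hr⟩, ObjectProperty.hom_ext _ <| Subtype.ext <| funext hrπ,
    ObjectProperty.hom_ext _ <| Subtype.ext <| funext hrp⟩

end GirySB

/-- The Giry monad on standard Borel spaces is Beck-Chevalley. -/
theorem mainTheorem3 : WeakCartesian.IsBeckChevalley GirySB.giry.{u} :=
  ⟨GirySB.preservesWeakPullbacks_probFunctor, GirySB.isWeaklyCartesian_giry_mul⟩
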